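/- All vector spaces are over $\mathbb C$, and $\Gamma$ is a group. A vertex algebra $(V,Y,\mathbf 1)$ is a vector space $V$ with a linear map $Y(\cdot,x):V\to\mathrm{Hom}(V,V((x)))$ and a vector $\mathbf 1\in V$ such that $Y(\mathbf 1,x)=1$, $Y(v,x)\mathbf 1\in V[[x]]$ has constant term $v$ for every $v\in V$, and the Jacobi identity holds: for $u,v\in V$, $$x_0^{-1}\delta\!\left(\tfrac{x_1-x_2}{x_0}\right)Y(u,x_1)Y(v,x_2)-x_0^{-1}\delta\!\left(\tfrac{x_2-x_1}{-x_0}\right)Y(v,x_2)Y(u,x_1)=x_2^{-1}\delta\!\left(\tfrac{x_1-x_0}{x_2}\right)Y(Y(u,x_0)v,x_2),$$ where $\delta(z)=\sum_{n\in\mathbb Z}z^n$ and powers of binomials are expanded in nonnegative powers of the second variable. A $\Gamma$-vertex algebra is a vertex algebra $V$ with group homomorphisms $R:\Gamma\to GL(V)$, $g\mapsto R_g$, and $\phi:\Gamma\to\mathbb C^\times$ such that $R_g\mathbf 1=\mathbf 1$ and $R_gY(v,x)R_g^{-1}=Y(R_gv,\phi(g)^{-1}x)$ for all $g\in\Gamma$,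 $v\in V$. The action is faithful if $R$ is injective. A quasimodule for a $\Gamma$-vertex algebra $V$ is a vector space $W$ with a linear map $Y_W(\cdot,x):V\to\mathrm{Hom}(W,W((x)))$ such that 1. $Y_W(\mathbf 1,x)=1$, and for all $u,v\in V$ there is a nonzero polynomial $p(x_1,x_2)\in\mathbb C[x_1,x_2]$ such that $$x_0^{-1}\delta\!\left(\tfrac{x_1-x_2}{x_0}\right)p(x_1,x_2)Y_W(u,x_1)Y_W(v,x_2)-x_0^{-1}\delta\!\left(\tfrac{x_2-x_1}{-x_0}\right)p(x_1,x_2)Y_W(v,x_2)Y_W(u,x_1)=x_2^{-1}\delta\!\left(\tfrac{x_1-x_0}{x_2}\right)p(x_1,x_2)Y_W(Y(u,x_0)v,x_2);$$ 2. $Y_W(R_gv,x)=Y_W(v,\phi(g)x)$ for all $g\in\Gamma$, $v\in V$; 3. for all $u,v\in V$ there are $k\ge 0$ and $\alpha_1,\dots,\alpha_k\in\phi(\Gamma)$ such that $(x_1-\alpha_1x_2)\cdots(x_1-\alpha_kx_2)[Y_W(u,x_1),Y_W(v,x_2)]=0$. It is faithful if the map $v\mapsto Y_W(v,x)$ is injective.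 **Corollary.** Let $V$ be a $\Gamma$-vertex algebra with a faithful action of $\Gamma$, and suppose that $V$ has a faithful quasimodule. Then $\Gamma$ is abelian and $\phi:\Gamma\to\mathbb C^\times$ is injective. Furthermore, for any $u,v\in V$, $$Y(R_gu,x)v\in V[[x]]\quad\text{for all but finitely many }g\in\Gamma,$$ and $$[Y(R_gu,x_1),Y(v,x_2)]=0\quad\text{for all but finitely many }g\in\Gamma;$$ these two assertions are equivalent: indeed, for each $g\in\Gamma$, $Y(R_gu,x)v\in V[[x]]$ if and only if $[Y(R_gu,x_1),Y(v,x_2)]=0$. -/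

import Mathlib

/-! Vertex algebras over `ℂ`, vertex algebras with a compatible action of a group `Γ`, and their
quasimodules.

Mathlib's `VertexOperator ℂ W` is `Hom(W, W((x)))`, and `HVertexOperator.coeff A n : W →ₗ[ℂ] W` is
the coefficient of `x ^ n` in `A(x)`. A formal series in several variables is the function sending a
tuple of integer exponents to the corresponding coefficient. -/

open HVertexOperator (coeff)

namespace VertexAlg

section Series

variable {V W M : Type*} [AddCommGroup V] [Module ℂ V] [AddCommGroup W] [Module ℂ W]
  [AddCommGroup M] [Module ℂ M]

/-- The product `p(x₁, x₂) F(x₁, x₂)` of a polynomial (`X 0` is `x₁`, `X 1` is `x₂`) with a doubly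
infinite formal series `F(x₁, x₂) = ∑ F i j x₁ ^ i x₂ ^ j`. -/
noncomputable def polyMul (p : MvPolynomial (Fin 2) ℂ) (F : ℤ → ℤ → M) : ℤ → ℤ → M :=
  fun i j => ∑ s ∈ p.support, p.coeff s • F (i - (s 0 : ℤ)) (j - (s 1 : ℤ))

/-- The commutator `[A(x₁), B(x₂)]`, as a formal series in `x₁, x₂` with coefficients in `End W`. -/
noncomputable def commutator (A B : VertexOperator ℂ W) : ℤ → ℤ → Module.End ℂ W :=
  fun i j => coeff A i ∘ₗ coeff B j - coeff B j ∘ₗ coeff A i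

/-- The coefficient of `x₀ ^ a x₁ ^ b x₂ ^ c` in
`x₀⁻¹ δ((x₁ - x₂) / x₀) A(x₁) B(x₂) w = ∑_{r ∈ ℤ} x₀ ^ (-r-1) (x₁ - x₂) ^ r A(x₁) B(x₂) w`, where
`(x₁ - x₂) ^ r = ∑_{i ≥ 0} (-1) ^ i (r choose i) x₁ ^ (r-i) x₂ ^ i`; only `r = -a-1` contributes.
The sum has finite support because `B(x₂) w` is a Laurent series. -/
noncomputable def deltaAB (A B : VertexOperator ℂ W) (w : W) (a b c : ℤ) : W :=
  ∑ᶠ i : ℕ, ((-1) ^ i * Ring.choose (-a - 1) i : ℤ) •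
    coeff A (b - (-a - 1 - i)) (coeff B (c - i) w)

/-- The coefficient of `x₀ ^ a x₁ ^ b x₂ ^ c` in
`x₀⁻¹ δ((x₂ - x₁) / (-x₀)) B(x₂) A(x₁) w = ∑_{r ∈ ℤ} (-1) ^ r x₀ ^ (-r-1) (x₂ - x₁) ^ r B(x₂) A(x₁) w`,
where `(x₂ - x₁) ^ r` is expanded in nonnegative powers of `x₁`.
The sum has finite support because `A(x₁) w` is a Laurent series. -/
noncomputable def deltaBA (A B : VertexOperator ℂ W) (w : W) (a b c : ℤ) : W :=
  ∑ᶠ i : ℕ, (Int.negOnePow (-a - 1) * ((-1) ^ i * Ring.choose (-a - 1) i) : ℤ) •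
    coeff B (c - (-a - 1 - i)) (coeff A (b - i) w)

/-- The coefficient of `x₀ ^ a x₁ ^ b x₂ ^ c` in
`x₂⁻¹ δ((x₁ - x₀) / x₂) Z(U(x₀) v, x₂) w = ∑_{r ∈ ℤ} x₂ ^ (-r-1) (x₁ - x₀) ^ r Z(U(x₀) v, x₂) w`,
where `(x₁ - x₀) ^ r = ∑_{i ≥ 0} (-1) ^ i (r choose i) x₁ ^ (r-i) x₀ ^ i`; only `r = b+i`
contributes. The sum has finite support because `U(x₀) v` is a Laurent series. -/
noncomputable def deltaIterate (Z : V →ₗ[ℂ] VertexOperator ℂ W) (U : VertexOperator ℂ V)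
    (v : V) (w : W) (a b c : ℤ) : W :=
  ∑ᶠ i : ℕ, ((-1) ^ i * Ring.choose (b + i) i : ℤ) •
    coeff (Z (coeff U (a - i) v)) (c + (b + i) + 1) w

end Series

/-- A vertex algebra structure on a complex vector space `V`: a vertex operator map
`Y(·, x) : V → Hom(V, V((x)))` and a vacuum vector satisfying the vacuum property, the creation
property and the Jacobi identity. -/
structure VertexAlgebra (V : Type*) [AddCommGroup V] [Module ℂ V] where
  /-- The vertex operator map `v ↦ Y(v, x)`. -/
  Y : V →ₗ[ℂ] VertexOperator ℂ V
  /-- The vacuum vector `𝟏`. -/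
  vac : V
  /-- `Y(𝟏, x) = 1`. -/
  vacuum : ∀ (n : ℤ) (v : V), coeff (Y vac) n v = if n = 0 then v else 0
  /-- `Y(v, x) 𝟏 ∈ V[[x]]`. -/
  creation_regular : ∀ (v : V) (n : ℤ), n < 0 → coeff (Y v) n vac = 0
  /-- `Y(v, x) 𝟏` has constant term `v`. -/
  creation : ∀ v : V, coeff (Y v) 0 vac = v
  /-- The Jacobi identity. -/
  jacobi : ∀ (u v w : V) (a b c : ℤ),
    deltaAB (Y u) (Y v) w a b c - deltaBA (Y u) (Y v) w a b c
      = deltaIterate Y (Y u) v w a b c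

/-- A quasimodule for a vertex algebra. -/
structure Quasimodule {V : Type*} [AddCommGroup V] [Module ℂ V] (A : VertexAlgebra V)
    (W : Type*) [AddCommGroup W] [Module ℂ W] where
  /-- The linear map `Y_W(·, x) : V → Hom(W, W((x)))`. -/
  YW : V →ₗ[ℂ] VertexOperator ℂ W
  /-- `Y_W(𝟏, x) = 1`. -/
  vacuum : ∀ (n : ℤ) (w : W), coeff (YW A.vac) n w = if n = 0 then w else 0
  /-- The Jacobi identity holds after multiplication by some nonzero polynomial `p(x₁, x₂)`. -/
  quasi_jacobi : ∀ u v : V, ∃ p : MvPolynomial (Fin 2) ℂ, p ≠ 0 ∧ ∀ (w : W) (a b c : ℤ),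
    polyMul p (deltaAB (YW u) (YW v) w a) b c - polyMul p (deltaBA (YW u) (YW v) w a) b c
      = polyMul p (deltaIterate YW (A.Y u) v w a) b c

/-- A `Γ`-vertex algebra. -/
structure GammaVertexAlgebra (Γ : Type*) [Group Γ] (V : Type*) [AddCommGroup V] [Module ℂ V]
    extends VertexAlgebra V where
  /-- The action `R : Γ → GL(V)`. -/
  R : Γ →* (V ≃ₗ[ℂ] V)
  /-- The character `φ : Γ → ℂˣ`. -/
  φ : Γ →* ℂˣ
  /-- `R_g 𝟏 = 𝟏`. -/
  R_vac : ∀ g : Γ, R g vac = vac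
  /-- `R_g Y(v, x) R_g⁻¹ = Y(R_g v, φ(g)⁻¹ x)`. -/
  R_conj : ∀ (g : Γ) (v : V) (n : ℤ) (w : V),
    R g (coeff (Y v) n ((R g).symm w)) = ((φ g : ℂ)⁻¹) ^ n • coeff (Y (R g v)) n w

/-- A quasimodule for a `Γ`-vertex algebra: a quasimodule for the underlying vertex algebra which is
equivariant and `φ(Γ)`-local. -/
structure GammaQuasimodule {Γ : Type*} [Group Γ] {V : Type*} [AddCommGroup V] [Module ℂ V]
    (A : GammaVertexAlgebra Γ V) (W : Type*) [AddCommGroup W] [Module ℂ W]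
    extends Quasimodule A.toVertexAlgebra W where
  /-- `Y_W(R_g v, x) = Y_W(v, φ(g) x)`. -/
  equivariant : ∀ (g : Γ) (v : V) (n : ℤ),
    coeff (YW (A.R g v)) n = (A.φ g : ℂ) ^ n • coeff (YW v) n
  /-- `(x₁ - α₁ x₂) ⋯ (x₁ - α_k x₂) [Y_W(u, x₁), Y_W(v, x₂)] = 0` for some `α_i ∈ φ(Γ)`. -/
  gamma_local : ∀ u v : V, ∃ (k : ℕ) (α : Fin k → ℂˣ), (∀ i, α i ∈ A.φ.range) ∧
    ∀ m n : ℤ, polyMul (∏ i, (MvPolynomial.X 0 - MvPolynomial.C (α i : ℂ) * MvPolynomial.X 1))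
      (commutator (YW u) (YW v)) m n = 0

/-- `A(x) v ∈ V[[x]]`. -/
def IsRegularOn {V : Type*} [AddCommGroup V] [Module ℂ V] (A : VertexOperator ℂ V) (v : V) : Prop :=
  ∀ n : ℤ, n < 0 → coeff A n v = 0

end VertexAlg

/-! By equivariance `Y_W(R_g v, x)` depends on `g` only through `φ(g)`, so the two faithfulness
hypotheses make `φ` injective, and `Γ` embeds in the abelian group `ℂˣ`.

The core is `Quasimodule.isRegularOn_of_shiftAction_commutator_eq_zero`. Let `z` be the lowest polar
coefficient of `Y(u, x) v`. Each Jacobi term turns multiplication by `x₁ - x₂` into multiplication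
by `x₀`, so powers of `x₁ - x₂` in the quasi-Jacobi polynomial only move the `x₀`-exponent, leaving
a factor `q` with `q(x, x) ≠ 0`. If `p` kills the commutator, then `p(x, x) q(x, x) Y_W(z, x) w =
0`; these Laurent series are bounded below, so `Y_W(z, x) = 0` and `z = 0`.

Replacing `u` by `R_g u` rescales `x₁` by `φ(g)`, and the locality polynomial becomes nonzero on the
diagonal unless `φ(g)` is some `α i`: finitely many `g`. The equivalence is the core applied to `V`
over itself. -/

open HVertexOperator (coeff)

namespace VertexAlg

section Series

variable {V W M : Type*} [AddCommGroup V] [Module ℂ V] [AddCommGroup W] [Module ℂ W]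
  [AddCommGroup M] [Module ℂ M]

/-! ### Polynomials acting on formal series -/

/-- Multiplication of doubly infinite series by monomials. -/
def monomialShift (M : Type*) [AddCommGroup M] [Module ℂ M] :
    Multiplicative (Fin 2 →₀ ℕ) →* Module.End ℂ (ℤ → ℤ → M) where
  toFun s :=
    { toFun := fun F i j => F (i - (s.toAdd 0 : ℤ)) (j - (s.toAdd 1 : ℤ))
      map_add' := fun _ _ => rfl
      map_smul' := fun _ _ => rfl }
  map_one' := by ext F i j; simp
  map_mul' s t := by
    ext F i j
    simp only [toAdd_mul, Finsupp.add_apply, Nat.cast_add, LinearMap.coe_mk, AddHom.coe_mk,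
      Module.End.mul_apply, sub_sub]

/-- The action of `ℂ[x₁, x₂]` on doubly infinite series. -/
noncomputable def shiftAction (M : Type*) [AddCommGroup M] [Module ℂ M] :
    MvPolynomial (Fin 2) ℂ →ₐ[ℂ] Module.End ℂ (ℤ → ℤ → M) :=
  AddMonoidAlgebra.lift ℂ _ _ (monomialShift M)

theorem polyMul_eq_shiftAction (p : MvPolynomial (Fin 2) ℂ) (F : ℤ → ℤ → M) :
    polyMul p F = shiftAction M p F := by
  ext i j
  have h : shiftAction M p = ∑ s ∈ p.support, p.coeff s • monomialShift M (.ofAdd s) :=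
    AddMonoidAlgebra.lift_apply _ _
  rw [h, LinearMap.sum_apply, Finset.sum_apply, Finset.sum_apply]
  rfl

theorem shiftAction_monomial (s : Fin 2 →₀ ℕ) (c : ℂ) (F : ℤ → ℤ → M) (i j : ℤ) :
    shiftAction M (MvPolynomial.monomial s c) F i j = c • F (i - (s 0 : ℤ)) (j - (s 1 : ℤ)) := by
  have h : shiftAction M (MvPolynomial.monomial s c) = c • monomialShift M (.ofAdd s) :=
    AddMonoidAlgebra.lift_single _ _ _
  rw [h]
  rfl

@[simp]
theorem shiftAction_C (c : ℂ) : shiftAction M (MvPolynomial.C c) = c • 1 := by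
  ext F i j
  rw [MvPolynomial.C_apply, shiftAction_monomial]
  simp

@[simp]
theorem shiftAction_X_zero (F : ℤ → ℤ → M) (i j : ℤ) :
    shiftAction M (MvPolynomial.X 0) F i j = F (i - 1) j := by
  rw [MvPolynomial.X, shiftAction_monomial]
  simp

@[simp]
theorem shiftAction_X_one (F : ℤ → ℤ → M) (i j : ℤ) :
    shiftAction M (MvPolynomial.X 1) F i j = F i (j - 1) := by
  rw [MvPolynomial.X, shiftAction_monomial]
  simp

theorem shiftAction_comp_linearMap (f : M →ₗ[ℂ] W) (p : MvPolynomial (Fin 2) ℂ)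
    (F : ℤ → ℤ → M) (i j : ℤ) :
    shiftAction W p (fun i j => f (F i j)) i j = f (shiftAction M p F i j) := by
  simp only [← polyMul_eq_shiftAction, polyMul, map_sum, map_smul]

/-- Multiplication by `x` on the doubly infinite series in one variable. -/
def shift (M : Type*) [AddCommGroup M] [Module ℂ M] : Module.End ℂ (ℤ → M) where
  toFun h n := h (n - 1)
  map_add' _ _ := rfl
  map_smul' _ _ := rfl

theorem shift_pow_apply (k : ℕ) (h : ℤ → M) (n : ℤ) : (shift M ^ k) h n = h (n - k) := by
  induction k generalizing n with
  | zero => simp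
  | succ k ih =>
    rw [pow_succ', Module.End.mul_apply]
    change (shift M ^ k) h (n - 1) = _
    rw [ih]
    congr 1
    push_cast
    ring

/-- A nonzero polynomial acts injectively on series that are bounded below. -/
theorem eq_zero_of_aeval_shift_eq_zero {P : Polynomial ℂ} (hP : P ≠ 0) {h : ℤ → M} {N : ℤ}
    (hN : ∀ n < N, h n = 0) (h0 : Polynomial.aeval (shift M) P h = 0) : h = 0 := by
  by_contra hne
  have hex : ∃ k : ℕ, h (N + k) ≠ 0 := by
    obtain ⟨n, hn⟩ := Function.ne_iff.mp hne
    have : N ≤ n := by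
      by_contra hlt
      exact hn (hN n (not_le.mp hlt))
    refine ⟨(n - N).toNat, ?_⟩
    rwa [Int.toNat_of_nonneg (by omega), add_sub_cancel]
  classical
  have hlow : ∀ n < N + Nat.find hex, h n = 0 := by
    intro n hn
    by_cases hnN : n < N
    · exact hN n hnN
    · have := Nat.find_min hex (m := (n - N).toNat) (by omega)
      rwa [Int.toNat_of_nonneg (by omega), add_sub_cancel, not_not] at this
  -- Here only the product of the two lowest terms survives.
  have hev := congrFun h0 (N + Nat.find hex + P.natTrailingDegree)
  rw [Polynomial.aeval_eq_sum_range, LinearMap.sum_apply, Finset.sum_apply,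
    Finset.sum_eq_single P.natTrailingDegree] at hev
  · simp only [LinearMap.smul_apply, Pi.smul_apply, shift_pow_apply, add_sub_cancel_right,
      Pi.zero_apply, smul_eq_zero] at hev
    rcases hev with hev | hev
    · exact hP (Polynomial.trailingCoeff_eq_zero.mp hev)
    · exact Nat.find_spec hex hev
  · intro k _ hk
    simp only [LinearMap.smul_apply, Pi.smul_apply, shift_pow_apply]
    rcases lt_or_gt_of_ne hk with hk | hk
    · rw [Polynomial.coeff_eq_zero_of_lt_natTrailingDegree hk, zero_smul]
    · rw [hlow _ (by omega), smul_zero]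
  · intro hk
    exact absurd (Finset.mem_range.mpr (Nat.lt_succ_of_le P.natTrailingDegree_le_natDegree)) hk

/-! ### Restriction to the diagonal -/

/-- The restriction `p(x, x)` of a polynomial to the diagonal. -/
noncomputable def diagonal : MvPolynomial (Fin 2) ℂ →ₐ[ℂ] Polynomial ℂ :=
  MvPolynomial.aeval fun _ => Polynomial.X

/-- The series is `x₂⁻¹ δ(x₁ / x₂) h(x₂)`, on which `x₁` and `x₂` act alike. -/
theorem shiftAction_diagonal (p : MvPolynomial (Fin 2) ℂ) (h : ℤ → M) (b c : ℤ) :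
    shiftAction M p (fun b c => h (b + c + 1)) b c
      = Polynomial.aeval (shift M) (diagonal p) h (b + c + 1) := by
  induction p using MvPolynomial.induction_on generalizing h b c with
  | C a => simp [diagonal, Polynomial.aeval_C, Module.algebraMap_end_apply]
  | add p q hp hq => simp [map_add, hp, hq]
  | mul_X p i hp =>
    have key : shiftAction M (MvPolynomial.X i) (fun b c => h (b + c + 1))
        = fun b c => shift M h (b + c + 1) := by
      ext b c
      fin_cases i <;> simp [shift] <;> congr 1 <;> ring
    rw [map_mul, Module.End.mul_apply, key, hp, map_mul, map_mul, Module.End.mul_apply]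
    simp [diagonal]

/-- The quotient map modulo `x₁ - x₂` factors through `diagonal`. -/
theorem X_sub_X_dvd_of_diagonal_eq_zero {p : MvPolynomial (Fin 2) ℂ} (hp : diagonal p = 0) :
    (MvPolynomial.X 0 - MvPolynomial.X 1) ∣ p := by
  rw [← Ideal.mem_span_singleton, ← Ideal.Quotient.eq_zero_iff_mem]
  set I : Ideal (MvPolynomial (Fin 2) ℂ) :=
    Ideal.span {MvPolynomial.X 0 - MvPolynomial.X 1}
  have hX : Ideal.Quotient.mkₐ ℂ I (MvPolynomial.X 0) =
      Ideal.Quotient.mkₐ ℂ I (MvPolynomial.X 1) :=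
    Ideal.Quotient.eq.mpr (Ideal.subset_span rfl)
  have h : (Polynomial.aeval (Ideal.Quotient.mkₐ ℂ I (MvPolynomial.X 1))).comp diagonal
      = Ideal.Quotient.mkₐ ℂ I := by
    ext i
    fin_cases i <;> simp [diagonal, ← hX]
  have := DFunLike.congr_fun h p
  rw [AlgHom.comp_apply, hp, map_zero] at this
  exact this.symm

theorem exists_eq_X_sub_X_pow_mul {p : MvPolynomial (Fin 2) ℂ} (hp : p ≠ 0) :
    ∃ (s : ℕ) (q : MvPolynomial (Fin 2) ℂ), diagonal q ≠ 0 ∧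
      p = (MvPolynomial.X 0 - MvPolynomial.X 1) ^ s * q := by
  have hunit : ¬ IsUnit (MvPolynomial.X 0 - MvPolynomial.X 1 : MvPolynomial (Fin 2) ℂ) := by
    intro h
    have := h.map diagonal
    simp [diagonal] at this
  obtain ⟨s, q, hq, hpq⟩ := WfDvdMonoid.max_power_factor' hp hunit
  exact ⟨s, q, fun h => hq (X_sub_X_dvd_of_diagonal_eq_zero h), hpq⟩

theorem exists_coeff_eq_zero (A : VertexOperator ℂ W) (w : W) :
    ∃ N : ℤ, ∀ n < N, coeff A n w = 0 :=
  ⟨_, fun n hn => VertexOperator.coeff_eq_zero_of_lt_order A n w hn⟩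

/-! ### The three delta-function terms of the Jacobi identity -/

/-- The product `(x₁ - x₂) ^ r F(x₁, x₂)`, with the binomial expanded in nonnegative powers of
`x₂`. -/
noncomputable def binomMul (F : ℤ → ℤ → M) (r b c : ℤ) : M :=
  ∑ᶠ i : ℕ, ((-1) ^ i * Ring.choose r i : ℤ) • F (b - (r - i)) (c - i)

theorem finsum_eq_sum_range {M : Type*} [AddCommGroup M] {f : ℕ → M} {N : ℕ} (hf : ∀ i, N ≤ i → f i = 0) :
    ∑ᶠ i, f i = ∑ i ∈ Finset.range N, f i := by
  refine finsum_eq_sum_of_support_subset _ fun i hi => ?_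
  by_contra h
  exact hi (hf i (by simpa using h))

/-- Pascal's rule; the lower bound in the second exponent makes the sums finite. -/
theorem binomMul_add_one {M : Type*} [AddCommGroup M] {F : ℤ → ℤ → M} {N : ℤ}
    (hF : ∀ m, ∀ n < N, F m n = 0) (r b c : ℤ) :
    binomMul F (r + 1) b c = binomMul F r (b - 1) c - binomMul F r b (c - 1) := by
  have hK (i : ℕ) (hi : (c - N).toNat + 1 ≤ i) : c - i < N := by omega
  rw [binomMul, binomMul, binomMul,
    finsum_eq_sum_range (N := (c - N).toNat + 1 + 1)
      fun i hi => by rw [hF _ _ (hK i (by omega)), smul_zero],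
    finsum_eq_sum_range (N := (c - N).toNat + 1 + 1)
      fun i hi => by rw [hF _ _ (hK i (by omega)), smul_zero],
    finsum_eq_sum_range (N := (c - N).toNat + 1)
      fun i hi => by rw [hF _ _ (by have := hK i hi; omega), smul_zero],
    Finset.sum_range_succ', Finset.sum_range_succ' _ ((c - N).toNat + 1),
    add_sub_right_comm (Finset.sum _ _),
    ← Finset.sum_sub_distrib]
  congr 1
  · refine Finset.sum_congr rfl fun i _ => ?_
    rw [Ring.choose_succ_succ,
      show b - (r + 1 - ((i + 1 : ℕ) : ℤ)) = b - (r - i) by push_cast; ring,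
      show b - 1 - (r - ((i + 1 : ℕ) : ℤ)) = b - (r - i) by push_cast; ring,
      show c - 1 - (i : ℤ) = c - ((i + 1 : ℕ) : ℤ) by push_cast; ring, ← sub_smul]
    congr 1
    ring
  · simp only [Ring.choose_zero_right]
    congr 2
    push_cast
    ring

theorem binomMul_zero {M : Type*} [AddCommGroup M] (F : ℤ → ℤ → M) (b c : ℤ) : binomMul F 0 b c = F b c := by
  rw [binomMul, finsum_eq_single _ 0]
  · simp
  · intro i hi
    rw [Ring.choose_zero_pos ℤ (Nat.pos_of_ne_zero hi), mul_zero, zero_smul]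

theorem deltaAB_eq_binomMul (A B : VertexOperator ℂ W) (w : W) (a b c : ℤ) :
    deltaAB A B w a b c = binomMul (fun m n => coeff A m (coeff B n w)) (-a - 1) b c := rfl

theorem deltaBA_eq_binomMul (A B : VertexOperator ℂ W) (w : W) (a b c : ℤ) :
    deltaBA A B w a b c = (Int.negOnePow (-a - 1) : ℤ) •
      binomMul (fun n m => coeff B n (coeff A m w)) (-a - 1) c b := by
  simp only [deltaBA, binomMul, mul_smul]
  obtain ⟨N, hN⟩ := exists_coeff_eq_zero A w
  refine (smul_finsum' _ ?_).symm
  refine (Set.finite_lt_nat ((b - N).toNat + 1)).subset fun i hi => ?_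
  by_contra h
  have h' : (b - N).toNat + 1 ≤ i := not_lt.mp h
  exact hi (by simp only [hN (b - i) (by omega), map_zero, smul_zero])

theorem deltaAB_sub_one (A B : VertexOperator ℂ W) (w : W) (a b c : ℤ) :
    deltaAB A B w (a - 1) b c = deltaAB A B w a (b - 1) c - deltaAB A B w a b (c - 1) := by
  obtain ⟨N, hN⟩ := exists_coeff_eq_zero B w
  rw [deltaAB_eq_binomMul, show -(a - 1) - 1 = -a - 1 + 1 by ring,
    binomMul_add_one (N := N) fun m n hn => by rw [hN n hn, map_zero]]
  rfl

theorem deltaBA_sub_one (A B : VertexOperator ℂ W) (w : W) (a b c : ℤ) :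
    deltaBA A B w (a - 1) b c = deltaBA A B w a (b - 1) c - deltaBA A B w a b (c - 1) := by
  obtain ⟨N, hN⟩ := exists_coeff_eq_zero A w
  simp only [deltaBA_eq_binomMul]
  rw [show -(a - 1) - 1 = -a - 1 + 1 by ring,
    binomMul_add_one (N := N) fun m n hn => by rw [hN n hn, map_zero], Int.negOnePow_succ,
    Units.val_neg, neg_smul, smul_sub, neg_sub]

theorem deltaAB_neg_one (A B : VertexOperator ℂ W) (w : W) (b c : ℤ) :
    deltaAB A B w (-1) b c = coeff A b (coeff B c w) := by
  rw [deltaAB_eq_binomMul]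
  exact binomMul_zero _ b c

theorem deltaBA_neg_one (A B : VertexOperator ℂ W) (w : W) (b c : ℤ) :
    deltaBA A B w (-1) b c = coeff B c (coeff A b w) := by
  rw [deltaBA_eq_binomMul, show (-(-1) - 1 : ℤ) = 0 by norm_num, binomMul_zero]
  simp

/-- Pascal's rule again: the delta function identifies `x₀` with `x₁ - x₂`. -/
theorem deltaIterate_sub_one (Z : V →ₗ[ℂ] VertexOperator ℂ W) (U : VertexOperator ℂ V) (v : V)
    (w : W) (a b c : ℤ) :
    deltaIterate Z U v w (a - 1) b c
      = deltaIterate Z U v w a (b - 1) c - deltaIterate Z U v w a b (c - 1) := by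
  obtain ⟨N, hN⟩ := exists_coeff_eq_zero U v
  have hK (d : ℤ) (n : ℤ) (hd : d < N) : coeff (Z (coeff U d v)) n w = 0 := by
    rw [hN d hd, map_zero, map_zero]
    rfl
  rw [deltaIterate, deltaIterate, deltaIterate,
    finsum_eq_sum_range (N := (a - N).toNat + 1)
      fun i hi => by rw [hK _ _ (by omega), smul_zero],
    finsum_eq_sum_range (N := (a - N).toNat + 1 + 1)
      fun i hi => by rw [hK _ _ (by omega), smul_zero],
    finsum_eq_sum_range (N := (a - N).toNat + 1 + 1)
      fun i hi => by rw [hK _ _ (by omega), smul_zero],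
    ← Finset.sum_sub_distrib, Finset.sum_range_succ' _ ((a - N).toNat + 1)]
  simp only [Ring.choose_zero_right, Nat.cast_zero, sub_zero, add_zero, pow_zero, mul_one]
  rw [show c + (b - 1) + 1 = c - 1 + b + 1 by ring, sub_self, add_zero]
  refine Finset.sum_congr rfl fun i _ => ?_
  have hch := Ring.choose_succ_succ (b + i) i
  rw [show b - 1 + ((i + 1 : ℕ) : ℤ) = b + i by push_cast; ring,
    show b + ((i + 1 : ℕ) : ℤ) = b + i + 1 by push_cast; ring,
    show a - ((i + 1 : ℕ) : ℤ) = a - 1 - i by push_cast; ring,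
    show c - 1 + (b + i + 1) + 1 = c + (b + i) + 1 by ring, ← sub_smul, hch]
  congr 1
  ring

theorem deltaIterate_of_lowest (Z : V →ₗ[ℂ] VertexOperator ℂ W) (U : VertexOperator ℂ V) (v : V)
    (w : W) (a b c : ℤ) (ha : ∀ n < a, coeff U n v = 0) :
    deltaIterate Z U v w a b c = coeff (Z (coeff U a v)) (b + c + 1) w := by
  rw [deltaIterate, finsum_eq_single _ 0]
  · simp [add_comm b c]
  · intro i hi
    rw [ha _ (by omega), map_zero, map_zero]
    exact smul_zero _

theorem shiftAction_X_sub_X_pow {T : ℤ → ℤ → ℤ → M}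
    (hT : ∀ a b c, T (a - 1) b c = T a (b - 1) c - T a b (c - 1)) (s : ℕ) (a : ℤ) :
    shiftAction M ((MvPolynomial.X 0 - MvPolynomial.X 1) ^ s) (T a) = T (a - s) := by
  induction s with
  | zero => simp
  | succ s ih =>
    rw [pow_succ', map_mul, Module.End.mul_apply, ih]
    ext b c
    rw [map_sub, LinearMap.sub_apply, Pi.sub_apply, Pi.sub_apply, shiftAction_X_zero,
      shiftAction_X_one, ← hT]
    congr 1
    push_cast
    ring

/-- The substitution `x₁ ↦ t x₁` is multiplicative. -/
theorem shiftAction_scale (t : ℂ) (ht : t ≠ 0) {k : ℕ} (α : Fin k → ℂ) (F : ℤ → ℤ → M) :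
    shiftAction M (∏ i, (MvPolynomial.C t * MvPolynomial.X 0
        - MvPolynomial.C (α i) * MvPolynomial.X 1)) (fun i j => t ^ i • F i j)
      = fun i j => t ^ i • shiftAction M (∏ i, (MvPolynomial.X 0
        - MvPolynomial.C (α i) * MvPolynomial.X 1)) F i j := by
  induction k generalizing F with
  | zero => simp
  | succ k ih =>
    rw [Fin.prod_univ_castSucc, Fin.prod_univ_castSucc, map_mul, map_mul, Module.End.mul_apply,
      Module.End.mul_apply, ← ih]
    congr 1
    ext i j
    simp only [map_sub, map_mul, shiftAction_C, LinearMap.sub_apply, Module.End.mul_apply,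
      LinearMap.smul_apply, Module.End.one_apply, Pi.sub_apply, Pi.smul_apply, shiftAction_X_zero,
      shiftAction_X_one, smul_sub, smul_smul, zpow_sub_one₀ ht]
    congr 2
    · field_simp
    · ring

end Series

/-! ### Regularity from commutators in a quasimodule -/

section Quasimodule

variable {V : Type*} [AddCommGroup V] [Module ℂ V] {W : Type*} [AddCommGroup W] [Module ℂ W]

/-- If `[Y_W(u, x₁), Y_W(v, x₂)]` is annihilated by a polynomial that does not vanish on the
diagonal, then `Y(u, x) v` has no pole. -/
theorem Quasimodule.isRegularOn_of_shiftAction_commutator_eq_zero {A : VertexAlgebra V}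
    (M : Quasimodule A W) (hM : Function.Injective M.YW) {u v : V} {p : MvPolynomial (Fin 2) ℂ}
    (hp : diagonal p ≠ 0) (hc : shiftAction _ p (commutator (M.YW u) (M.YW v)) = 0) :
    IsRegularOn (A.Y u) v := by
  obtain ⟨q₀, hq₀, hJ⟩ := M.quasi_jacobi u v
  obtain ⟨s, q, hq, rfl⟩ := exists_eq_X_sub_X_pow_mul hq₀
  have hreg : ∀ k : ℕ, coeff (A.Y u) (-1 - k) v = 0 := by
    by_contra! hex
    obtain ⟨N, hN⟩ := exists_coeff_eq_zero (A.Y u) v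
    -- The largest `k` gives the deepest pole.
    obtain ⟨k, hk, hmax⟩ : ∃ k : ℕ, coeff (A.Y u) (-1 - k) v ≠ 0 ∧
        ∀ n < (-1 - k : ℤ), coeff (A.Y u) n v = 0 := by
      have hfin : {k : ℕ | coeff (A.Y u) (-1 - k) v ≠ 0}.Finite :=
        (Set.finite_lt_nat ((-1 - N).toNat + 1)).subset fun k hk => by
          by_contra h
          have h' : (-1 - N).toNat + 1 ≤ k := not_lt.mp h
          exact hk (hN _ (by omega))
      obtain ⟨k, hk, hmax⟩ := hfin.exists_maximalFor id _ hex
      refine ⟨k, hk, fun n hn => ?_⟩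
      by_contra hne
      have hn' : (-1 - ((-1 - n).toNat : ℤ)) = n := by omega
      have := hmax (j := (-1 - n).toNat) (by change coeff _ _ v ≠ 0; rwa [hn']) (by simp; omega)
      simp at this
      omega
    refine hk (hM (HVertexOperator.coeff_inj (funext fun n => LinearMap.ext fun w => ?_)))
    rw [map_zero, map_zero]
    set h : ℤ → W := fun n => coeff (M.YW (coeff (A.Y u) (-1 - k) v)) n w with hh
    obtain ⟨L, hL⟩ := exists_coeff_eq_zero (M.YW (coeff (A.Y u) (-1 - k) v)) w
    suffices h0 : Polynomial.aeval (shift W) (diagonal (p * q)) h = 0 from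
      congrFun (eq_zero_of_aeval_shift_eq_zero (by rw [map_mul]; exact mul_ne_zero hp hq)
        hL h0) n
    set T : ℤ → ℤ → ℤ → W := fun a b c => deltaAB (M.YW u) (M.YW v) w a b c
      - deltaBA (M.YW u) (M.YW v) w a b c with hT
    have hTs : ∀ a b c, T (a - 1) b c = T a (b - 1) c - T a b (c - 1) := by
      intro a b c
      simp only [hT, deltaAB_sub_one, deltaBA_sub_one]
      abel
    have hJ' : shiftAction W q (T (-1 - k)) = shiftAction W q (fun b c => h (b + c + 1)) := by
      -- The offset `s` is absorbed by `(x₁ - x₂) ^ s`, landing at `-1 - k`, where the iterate has a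
      -- single term.
      have hJs : shiftAction W ((MvPolynomial.X 0 - MvPolynomial.X 1) ^ s * q) (T (-1 - k + s))
          = shiftAction W ((MvPolynomial.X 0 - MvPolynomial.X 1) ^ s * q)
            (deltaIterate M.YW (A.Y u) v w (-1 - k + s)) := by
        ext b c
        rw [← polyMul_eq_shiftAction _ (deltaIterate _ _ _ _ _), ← hJ, polyMul_eq_shiftAction,
          polyMul_eq_shiftAction, ← Pi.sub_apply, ← Pi.sub_apply, ← map_sub]
        rfl
      rw [mul_comm, map_mul, Module.End.mul_apply, Module.End.mul_apply,
        shiftAction_X_sub_X_pow hTs, shiftAction_X_sub_X_pow (deltaIterate_sub_one _ _ _ _),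
        add_sub_cancel_right] at hJs
      rw [hJs]
      congr 1
      ext b c
      exact deltaIterate_of_lowest _ _ _ _ _ _ _ hmax
    -- The `x₀⁻¹` coefficient is the commutator; further polar ones are its multiples by `(x₁ - x₂)
    -- ^ k`.
    have hT0 : shiftAction W p (T (-1)) = 0 := by
      have : T (-1) = fun b c =>
          LinearMap.applyₗ w (commutator (M.YW u) (M.YW v) b c) := by
        ext b c
        simp [hT, deltaAB_neg_one, deltaBA_neg_one, commutator]
      ext b c
      rw [this, shiftAction_comp_linearMap, hc]
      simp
    have hTk : shiftAction W p (T (-1 - k)) = 0 := by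
      rw [← shiftAction_X_sub_X_pow hTs, ← Module.End.mul_apply, ← map_mul, mul_comm, map_mul,
        Module.End.mul_apply, hT0, map_zero]
    ext m
    have := shiftAction_diagonal (p * q) h (m - 1) 0
    rw [map_mul, Module.End.mul_apply, ← hJ', ← Module.End.mul_apply, ← map_mul, mul_comm, map_mul,
      Module.End.mul_apply, hTk, map_zero] at this
    rw [mul_comm, show m = m - 1 + 0 + 1 by ring, ← this]
    rfl
  intro n hn
  have := hreg (-1 - n).toNat
  rwa [Int.toNat_of_nonneg (by omega), sub_sub_cancel] at this

/-- A vertex algebra is a quasimodule over itself. -/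
def VertexAlgebra.toQuasimodule (A : VertexAlgebra V) : Quasimodule A V where
  YW := A.Y
  vacuum := A.vacuum
  quasi_jacobi u v := ⟨1, one_ne_zero, fun w a b c => by
    simpa [polyMul_eq_shiftAction] using A.jacobi u v w a b c⟩

theorem VertexAlgebra.Y_injective (A : VertexAlgebra V) : Function.Injective A.Y := by
  intro u v h
  rw [← A.creation u, h, A.creation]

theorem VertexAlgebra.isRegularOn_iff_commutator_eq_zero (A : VertexAlgebra V) (u v : V) :
    IsRegularOn (A.Y u) v ↔ ∀ m n : ℤ, commutator (A.Y u) (A.Y v) m n = 0 := by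
  constructor
  · intro h m n
    ext w
    -- The residue in `x₀` sees only polar coefficients of `Y(u, x₀) v`.
    have := A.jacobi u v w (-1) m n
    rw [deltaAB_neg_one, deltaBA_neg_one, deltaIterate_of_lowest _ _ _ _ _ _ _
      fun k hk => h k (by omega), h _ (by norm_num), map_zero, map_zero] at this
    exact this
  · intro h
    refine A.toQuasimodule.isRegularOn_of_shiftAction_commutator_eq_zero A.Y_injective (p := 1)
      (by simp) ?_
    ext m n : 2
    rw [map_one]
    exact h m n

end Quasimodule

/-! ### Equivariance and finiteness over `Γ` -/

section GammaQuasimodule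

variable {Γ : Type*} [Group Γ] {V : Type*} [AddCommGroup V] [Module ℂ V]
  {A : GammaVertexAlgebra Γ V} {W : Type*} [AddCommGroup W] [Module ℂ W]

theorem GammaQuasimodule.φ_injective (M : GammaQuasimodule A W) (hA : Function.Injective A.R)
    (hM : Function.Injective M.YW) : Function.Injective A.φ := by
  intro g h hgh
  refine hA (LinearEquiv.ext fun v => hM (HVertexOperator.coeff_inj (funext fun n => ?_)))
  rw [M.equivariant, M.equivariant, hgh]

theorem GammaQuasimodule.finite_not_isRegularOn (M : GammaQuasimodule A W)
    (hA : Function.Injective A.R) (hM : Function.Injective M.YW) (u v : V) :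
    {g : Γ | ¬ IsRegularOn (A.Y (A.R g u)) v}.Finite := by
  obtain ⟨k, α, -, hα⟩ := M.gamma_local u v
  -- Exceptional `g` satisfy `φ(g) = α i` for some `i`.
  refine ((Set.finite_range α).preimage (M.φ_injective hA hM).injOn).subset fun g hg => ?_
  by_contra hmem
  refine hg (M.toQuasimodule.isRegularOn_of_shiftAction_commutator_eq_zero hM
    (p := ∏ i, (MvPolynomial.C (A.φ g : ℂ) * MvPolynomial.X 0
      - MvPolynomial.C (α i : ℂ) * MvPolynomial.X 1)) ?_ ?_)
  · rw [map_prod]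
    refine Finset.prod_ne_zero_iff.mpr fun i _ => ?_
    have : diagonal (MvPolynomial.C (A.φ g : ℂ) * MvPolynomial.X 0
        - MvPolynomial.C (α i : ℂ) * MvPolynomial.X 1)
        = Polynomial.C ((A.φ g : ℂ) - α i) * Polynomial.X := by
      simp [diagonal, sub_mul]
    rw [this]
    refine mul_ne_zero (Polynomial.C_ne_zero.mpr (sub_ne_zero.mpr fun h => ?_)) Polynomial.X_ne_zero
    exact hmem ⟨i, (Units.ext h).symm⟩
  · have : commutator (M.YW (A.R g u)) (M.YW v)
        = fun i j => (A.φ g : ℂ) ^ i • commutator (M.YW u) (M.YW v) i j := by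
      ext i j : 2
      simp only [commutator, M.equivariant, LinearMap.smul_comp, LinearMap.comp_smul, smul_sub]
    rw [this, shiftAction_scale _ (A.φ g).ne_zero]
    ext i j : 2
    rw [← polyMul_eq_shiftAction, hα, smul_zero]
    rfl

end GammaQuasimodule

end VertexAlg

theorem corollary2p14 {Γ : Type*} [Group Γ] {V : Type*} [AddCommGroup V] [Module ℂ V]
    (A : VertexAlg.GammaVertexAlgebra Γ V) (hA : Function.Injective A.R)
    {W : Type*} [AddCommGroup W] [Module ℂ W]
    (M : VertexAlg.GammaQuasimodule A W) (hM : Function.Injective M.YW) :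
    (∀ g h : Γ, g * h = h * g) ∧
    Function.Injective A.φ ∧
    ∀ u v : V,
      {g : Γ | ¬ VertexAlg.IsRegularOn (A.Y (A.R g u)) v}.Finite ∧
      {g : Γ | ¬ ∀ m n : ℤ, VertexAlg.commutator (A.Y (A.R g u)) (A.Y v) m n = 0}.Finite ∧
      ∀ g : Γ, VertexAlg.IsRegularOn (A.Y (A.R g u)) v ↔
        ∀ m n : ℤ, VertexAlg.commutator (A.Y (A.R g u)) (A.Y v) m n = 0 := by
  have hφ := M.φ_injective hA hM
  have hfin := M.finite_not_isRegularOn hA hM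
  refine ⟨fun g h => hφ (by rw [map_mul, map_mul, mul_comm]), hφ, fun u v => ⟨hfin u v, ?_, fun g =>
    A.isRegularOn_iff_commutator_eq_zero _ v⟩⟩
  simpa only [A.isRegularOn_iff_commutator_eq_zero] using hfin u v
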